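/- Let $K$ be a number field of degree $n=s+2t$ over $\mathbb Q$ with exactly $s$ real embeddings and $2t$ non-real complex embeddings, where $s,t\ge 1$. Put $m=s+t$. Let $\sigma_1,\dots,\sigma_s$ be the real embeddings and let $\sigma_{s+1},\dots,\sigma_m$ consist of one embedding from each pair of complex conjugate non-real embeddings. Let $U\le\mathcal O_K^*$ be a group of units of rank $s$ that is admissible for $K$: $\sigma_i(a)>0$ for all $a\in U$ and $1\le i\le s$, and $\{(\log\sigma_1(a),\dots,\log\sigma_s(a)) : a\in U\}$ is a full lattice (a discrete subgroup that spans) in $\mathbb R^s$. Let $M\le\mathcal O_K$ be an additive subgroup of rank $n$ with $aM\subseteq M$ for all $a\in U$. The group $\Gamma=U\ltimes M$ acts freely and properly discontinuously on $\mathbb H^s\times\mathbb C^t$, where $\mathbb H$ is the upper half plane, by $$(a,x)(z_1,\dots,z_m)=\bigl(\sigma_1(ax)+\sigma_1(a)z_1,\dots,\sigma_m(ax)+\sigma_m(a)z_m\bigr).$$ Let $X=X(M,U)=(\mathbb H^s\times\mathbb C^t)/\Gamma$ be the quotient complex manifold (a generalised OT-manifold). Then $X$ has no nonzero holomorphic vector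 fields: $H^0(X,T_X)=0$, where $T_X$ is the holomorphic tangent bundle of $X$. -/

import Mathlib

open scoped Manifold ContDiff NumberField Topology
open NumberField

noncomputable section

namespace OT

section Field

variable (K : Type*) [Field K] [NumberField K]

/-- The logarithmic map of the units at the real places,
`u ↦ (log |σ₁(u)|, …, log |σ_s(u)|) ∈ ℝˢ`. On units that are positive under every real embedding
it is `u ↦ (log σ₁(u), …, log σ_s(u))`, the projection to `ℝˢ` of Dirichlet's logarithmic map. -/
def realLog : Additive (𝓞 K)ˣ →+ ({w : InfinitePlace K // w.IsReal} → ℝ) where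
  toFun u := fun w => Real.log (w.1 ((u.toMul : 𝓞 K) : K))
  map_zero' := by ext w; simp
  map_add' u v := by
    ext w
    have hu : w.1 ((u.toMul : 𝓞 K) : K) ≠ 0 := by simp
    have hv : w.1 ((v.toMul : 𝓞 K) : K) ≠ 0 := by simp
    simp [Real.log_mul hu hv]

variable {K}

/-- A group `U` of units is admissible for `K` if its elements are positive under all `s` real
embeddings, its rank is `s`, and its image in `ℝˢ` under the logarithmic map at the real places is
a full lattice, i.e. it is discrete and spans `ℝˢ`. -/
structure IsAdmissible (U : Subgroup (𝓞 K)ˣ) : Prop where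
  /-- The elements of `U` are totally positive. (At a real place `w.embedding` is the real
  embedding that defines `w`.) -/
  pos : ∀ u ∈ U, ∀ w : InfinitePlace K, w.IsReal → 0 < (w.embedding ((u : 𝓞 K) : K)).re
  rank_eq : Module.finrank ℤ (Additive U) = InfinitePlace.nrRealPlaces K
  discrete : DiscreteTopology (U.toAddSubgroup.map (realLog K))
  span_eq_top :
    Submodule.span ℝ (U.toAddSubgroup.map (realLog K) :
      Set ({w : InfinitePlace K // w.IsReal} → ℝ)) = ⊤

end Field

/-- The data from which an OT-manifold `X(M, U)` is built: a number field `K` with `s > 0` real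
and `2t > 0` non-real embeddings, a choice of one embedding for each of its `m = s + t` infinite
places, an admissible group of units `U`, and an additive subgroup `M` of `𝓞 K` of full rank that
is stable under `U`. -/
structure Datum (K : Type*) [Field K] [NumberField K] where
  exists_isReal : ∃ w : InfinitePlace K, w.IsReal
  exists_isComplex : ∃ w : InfinitePlace K, w.IsComplex
  /-- The embeddings `σ₁, …, σ_m`: the real ones, and one of each pair of conjugate ones. -/
  σ : InfinitePlace K → (K →+* ℂ)
  mk_σ : ∀ w, InfinitePlace.mk (σ w) = w
  U : Subgroup (𝓞 K)ˣ
  admissible : IsAdmissible U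
  M : AddSubgroup (𝓞 K)
  rank_M : Module.finrank ℤ M = Module.finrank ℚ K
  mul_mem : ∀ u ∈ U, ∀ x ∈ M, (u : 𝓞 K) * x ∈ M

/-- The space `ℍˢ × ℂᵗ`, as an open subset of `ℂᵐ`: the coordinates at the real places have
positive imaginary part. -/
def halfSpace (K : Type*) [Field K] [NumberField K] :
    TopologicalSpace.Opens (InfinitePlace K → ℂ) where
  carrier := {z | ∀ w : InfinitePlace K, w.IsReal → 0 < (z w).im}
  is_open' := by
    have h : {z : InfinitePlace K → ℂ | ∀ w : InfinitePlace K, w.IsReal → 0 < (z w).im} =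
        ⋂ w : InfinitePlace K, {z | w.IsReal → 0 < (z w).im} := by
      ext z; simp
    rw [h]
    refine isOpen_iInter_of_finite fun w => ?_
    by_cases hw : w.IsReal
    · simp only [hw, true_imp_iff]
      exact isOpen_lt continuous_const (by fun_prop)
    · simp [hw]

variable {K : Type*} [Field K] [NumberField K]

namespace Datum

variable (D : Datum K)

lemma σ_of_isReal {w : InfinitePlace K} (hw : w.IsReal) : D.σ w = w.embedding := by
  have h : ComplexEmbedding.IsReal (D.σ w) := by
    rw [← InfinitePlace.isReal_mk_iff, D.mk_σ]; exact hw
  conv_rhs => rw [← D.mk_σ w]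
  exact (InfinitePlace.embedding_mk_eq_of_isReal h).symm

lemma im_σ {w : InfinitePlace K} (hw : w.IsReal) (x : K) : (D.σ w x).im = 0 := by
  rw [D.σ_of_isReal hw, ← InfinitePlace.embedding_of_isReal_apply hw]
  exact Complex.ofReal_im _

lemma σ_unit_pos {w : InfinitePlace K} (hw : w.IsReal) (u : D.U) :
    0 < (D.σ w ((u.1 : 𝓞 K) : K)).re := by
  rw [D.σ_of_isReal hw]
  exact D.admissible.pos u.1 u.2 w hw

/-- The multiplication action of `U` on the additive group `M`. -/
instance : DistribMulAction D.U D.M where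
  smul u x := ⟨(u.1 : 𝓞 K) * x.1, D.mul_mem u.1 u.2 x.1 x.2⟩
  one_smul x := Subtype.ext (one_mul x.1)
  mul_smul u v x := Subtype.ext (mul_assoc (u.1 : 𝓞 K) (v.1 : 𝓞 K) x.1)
  smul_zero u := Subtype.ext (mul_zero (u.1 : 𝓞 K))
  smul_add u x y := Subtype.ext (mul_add (u.1 : 𝓞 K) x.1 y.1)

lemma coe_smul_M (u : D.U) (x : D.M) : ((u • x : D.M) : 𝓞 K) = (u.1 : 𝓞 K) * x.1 := rfl

/-- The action of `U` on `M`, as a homomorphism to the automorphism group. -/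
def actHom : D.U →* MulAut (Multiplicative D.M) where
  toFun u := AddEquiv.toMultiplicative (DistribMulAction.toAddAut D.U D.M u)
  map_one' := by ext x; simp
  map_mul' u v := MulEquiv.ext fun x => congrArg Multiplicative.ofAdd (mul_smul u v x.toAdd)

/-- The semidirect product `Γ = U ⋉ M`. In Mathlib's convention an element is written with its
normal factor first: `⟨y, a⟩` is "multiply by `a`, then translate by `y`". The element that is
written `(a, x)` in the convention "translate by `x`, then multiply by `a`" is `⟨a x, a⟩`. -/
abbrev Γ : Type _ := Multiplicative D.M ⋊[D.actHom] D.U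

/-- The translation part `y ∈ M` of `γ ∈ Γ`. -/
def trans (γ : D.Γ) : 𝓞 K := (γ.left.toAdd : D.M).1

/-- The multiplier `a ∈ U` of `γ ∈ Γ`. -/
def mult (γ : D.Γ) : 𝓞 K := (γ.right.1 : 𝓞 K)

lemma trans_one : D.trans 1 = 0 := rfl

lemma mult_one : D.mult 1 = 1 := rfl

lemma trans_mul (γ δ : D.Γ) : D.trans (γ * δ) = D.trans γ + D.mult γ * D.trans δ := rfl

lemma mult_mul (γ δ : D.Γ) : D.mult (γ * δ) = D.mult γ * D.mult δ := rfl

/-- The action of `Γ` on `ℍˢ × ℂᵗ` by affine maps: the element with translation part `y` and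
multiplier `a` sends `z` to `(σ₁(y) + σ₁(a) z₁, …, σ_m(y) + σ_m(a) z_m)`; with `y = a x` this is
`(σ₁(a x) + σ₁(a) z₁, …, σ_m(a x) + σ_m(a) z_m)`. -/
instance : MulAction D.Γ (halfSpace K) where
  smul γ z := ⟨fun w => D.σ w (D.trans γ : K) + D.σ w (D.mult γ : K) * z.1 w, fun w hw => by
    have h1 := D.im_σ hw (D.trans γ : K)
    have h2 := D.im_σ hw (D.mult γ : K)
    have h3 : 0 < (D.σ w (D.mult γ : K)).re := D.σ_unit_pos hw γ.right
    have h4 := z.2 w hw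
    simp only [Complex.add_im, Complex.mul_im, h1, h2]
    have := mul_pos h3 h4
    simpa using this⟩
  one_smul z := by
    ext w
    change D.σ w ((D.trans 1 : 𝓞 K) : K) + D.σ w ((D.mult 1 : 𝓞 K) : K) * z.1 w = z.1 w
    simp [trans_one, mult_one]
  mul_smul γ δ z := by
    ext w
    change D.σ w ((D.trans (γ * δ) : 𝓞 K) : K) + D.σ w ((D.mult (γ * δ) : 𝓞 K) : K) * z.1 w
      = D.σ w (D.trans γ : K) + D.σ w (D.mult γ : K) *
        (D.σ w (D.trans δ : K) + D.σ w (D.mult δ : K) * z.1 w)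
    simp only [trans_mul, mult_mul, map_add, map_mul]
    ring

lemma smul_apply (γ : D.Γ) (z : halfSpace K) (w : InfinitePlace K) :
    (γ • z).1 w = D.σ w (D.trans γ : K) + D.σ w (D.mult γ : K) * z.1 w := rfl

lemma ext_Γ {γ δ : D.Γ} (h1 : D.trans γ = D.trans δ) (h2 : D.mult γ = D.mult δ) : γ = δ :=
  SemidirectProduct.ext (Multiplicative.toAdd.injective (Subtype.ext h1))
    (Subtype.ext (Units.ext h2))

instance : ContinuousConstSMul D.Γ (halfSpace K) where
  continuous_const_smul γ := by
    refine Continuous.subtype_mk (continuous_pi fun w => ?_) _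
    have : Continuous fun z : halfSpace K => z.1 w :=
      (continuous_apply w).comp continuous_subtype_val
    exact continuous_const.add (continuous_const.mul this)

/-- The action is free. -/
instance : IsCancelSMul D.Γ (halfSpace K) := by
  rw [isCancelSMul_iff_eq_one_of_smul_eq]
  intro γ z h
  have hw (w : InfinitePlace K) :
      D.σ w (D.trans γ : K) + D.σ w (D.mult γ : K) * z.1 w = z.1 w := by
    rw [← D.smul_apply, h]
  obtain ⟨w, hr⟩ := D.exists_isReal
  have ha : D.mult γ = 1 := by
    have h1 := congrArg Complex.im (hw w)
    have h2 := z.2 w hr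
    simp only [Complex.add_im, Complex.mul_im, D.im_σ hr] at h1
    have h3 : (D.σ w (D.mult γ : K)).re = 1 := by
      have : ((D.σ w (D.mult γ : K)).re - 1) * (z.1 w).im = 0 := by linarith
      rcases mul_eq_zero.1 this with h | h
      · linarith
      · exact absurd h h2.ne'
    have h4 : D.σ w (D.mult γ : K) = 1 := Complex.ext (by simpa using h3)
      (by simpa using D.im_σ hr _)
    have h5 : (D.mult γ : K) = 1 := (D.σ w).injective (by simpa using h4)
    exact_mod_cast h5
  refine D.ext_Γ ?_ (ha.trans D.mult_one.symm)
  have h1 := hw w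
  rw [ha] at h1
  have h2 : D.σ w (D.trans γ : K) = 0 := by simpa using h1
  have h5 : (D.trans γ : K) = 0 := (D.σ w).injective (by simpa using h2)
  rw [trans_one]
  exact_mod_cast h5

lemma place_unit {w : InfinitePlace K} (hw : w.IsReal) (u : D.U) :
    w ((u.1 : 𝓞 K) : K) = (D.σ w ((u.1 : 𝓞 K) : K)).re := by
  conv_lhs => rw [← D.mk_σ w]
  rw [InfinitePlace.apply]
  have h : D.σ w ((u.1 : 𝓞 K) : K) = (((D.σ w ((u.1 : 𝓞 K) : K)).re : ℝ) : ℂ) :=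
    Complex.ext (by simp) (by simpa using D.im_σ hw _)
  rw [h, Complex.norm_real, Complex.ofReal_re]
  exact abs_of_pos (D.σ_unit_pos hw u)

/-- Only finitely many elements of `U` have bounded logarithms at the real places. -/
lemma finite_units (C : ℝ) :
    {u : D.U | ∀ w : InfinitePlace K, w.IsReal →
      |Real.log (D.σ w ((u.1 : 𝓞 K) : K)).re| ≤ C}.Finite := by
  have : Fintype {w : InfinitePlace K // w.IsReal} := Fintype.ofFinite _
  set L := D.U.toAddSubgroup.map (realLog K) with hL
  have : DiscreteTopology L := D.admissible.discrete
  have hfin : (Metric.closedBall (0 : {w : InfinitePlace K // w.IsReal} → ℝ) C ∩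
      (L : Set ({w : InfinitePlace K // w.IsReal} → ℝ))).Finite :=
    Metric.finite_isBounded_inter_isClosed DiscreteTopology.isDiscrete
      Metric.isBounded_closedBall (AddSubgroup.isClosed_of_discrete (H := L))
  refine Set.Finite.of_finite_image (f := fun u : D.U => realLog K (Additive.ofMul u.1))
    (hfin.subset ?_) ?_
  · rintro _ ⟨u, hu, rfl⟩
    refine ⟨?_, ⟨Additive.ofMul u.1, u.2, rfl⟩⟩
    have hC : 0 ≤ C := by
      obtain ⟨w, hw⟩ := D.exists_isReal
      exact (abs_nonneg _).trans (hu w hw)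
    rw [mem_closedBall_zero_iff, pi_norm_le_iff_of_nonneg hC]
    intro w
    change ‖Real.log (w.1 ((u.1 : 𝓞 K) : K))‖ ≤ C
    rw [D.place_unit w.2]
    exact hu w.1 w.2
  · intro u _ v _ huv
    obtain ⟨w, hw⟩ := D.exists_isReal
    have h1 : Real.log (w ((u.1 : 𝓞 K) : K)) = Real.log (w ((v.1 : 𝓞 K) : K)) :=
      congrFun huv ⟨w, hw⟩
    rw [D.place_unit hw, D.place_unit hw] at h1
    have h2 := Real.log_injOn_pos (D.σ_unit_pos hw u) (D.σ_unit_pos hw v) h1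
    have h3 : D.σ w ((u.1 : 𝓞 K) : K) = D.σ w ((v.1 : 𝓞 K) : K) :=
      Complex.ext h2 (by rw [D.im_σ hw, D.im_σ hw])
    have h4 : ((u.1 : 𝓞 K) : K) = ((v.1 : 𝓞 K) : K) := (D.σ w).injective h3
    exact Subtype.ext (Units.ext (by exact_mod_cast h4))

/-- Only finitely many algebraic integers are bounded under all the `σ w`. -/
lemma finite_integers (B : ℝ) : {x : 𝓞 K | ∀ w, ‖D.σ w (x : K)‖ ≤ B}.Finite := by
  refine Set.Finite.of_finite_image (f := fun x : 𝓞 K => (x : K))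
    ((Embeddings.finite_of_norm_le K ℂ B).subset ?_) (RingOfIntegers.coe_injective.injOn)
  rintro _ ⟨x, hx, rfl⟩
  refine ⟨x.isIntegral_coe, fun φ => ?_⟩
  have := hx (InfinitePlace.mk φ)
  rwa [← InfinitePlace.apply, D.mk_σ, InfinitePlace.apply] at this

/-- The action is properly discontinuous. -/
instance : ProperlyDiscontinuousSMul D.Γ (halfSpace K) where
  finite_disjoint_inter_image {A B} hA hB := by
    have bound (S : Set (halfSpace K)) (hS : IsCompact S) : ∃ C : ℝ, ∀ z ∈ S,
        (∀ w, ‖z.1 w‖ ≤ C) ∧ ∀ w : InfinitePlace K, w.IsReal → |Real.log (z.1 w).im| ≤ C := by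
      have h1 (w : InfinitePlace K) : ∃ C : ℝ, ∀ z ∈ S, ‖z.1 w‖ ≤ C :=
        hS.exists_bound_of_continuousOn
          ((continuous_apply w).comp continuous_subtype_val).continuousOn
      have h2 (w : InfinitePlace K) : ∃ C : ℝ, ∀ z ∈ S, w.IsReal →
          |Real.log (z.1 w).im| ≤ C := by
        by_cases hw : w.IsReal
        · have hc : Continuous fun z : halfSpace K => (z.1 w).im :=
            Complex.continuous_im.comp ((continuous_apply w).comp continuous_subtype_val)
          obtain ⟨C, hC⟩ := hS.exists_bound_of_continuousOn
            (f := fun z : halfSpace K => Real.log (z.1 w).im)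
            (hc.log fun z => (z.2 w hw).ne').continuousOn
          exact ⟨C, fun z hz _ => hC z hz⟩
        · exact ⟨0, fun z _ h => absurd h hw⟩
      choose C₁ hC₁ using h1
      choose C₂ hC₂ using h2
      refine ⟨∑ w, (|C₁ w| + |C₂ w|), fun z hz => ?_⟩
      have hle (w : InfinitePlace K) : |C₁ w| + |C₂ w| ≤ ∑ w, (|C₁ w| + |C₂ w|) :=
        Finset.single_le_sum (f := fun w => |C₁ w| + |C₂ w|) (fun i _ => by positivity)
          (Finset.mem_univ w)
      refine ⟨fun w => ?_, fun w hw => ?_⟩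
      · linarith [hle w, hC₁ w z hz, le_abs_self (C₁ w), abs_nonneg (C₂ w)]
      · linarith [hle w, hC₂ w z hz hw, le_abs_self (C₂ w), abs_nonneg (C₁ w)]
    obtain ⟨a, ha⟩ := bound A hA
    obtain ⟨b, hb⟩ := bound B hB
    have hU := D.finite_units (a + b)
    have hfin : (⋃ u ∈ {u : D.U | ∀ w : InfinitePlace K, w.IsReal →
        |Real.log (D.σ w ((u.1 : 𝓞 K) : K)).re| ≤ a + b},
        (fun x : 𝓞 K => (x, (u.1 : 𝓞 K))) '' {x : 𝓞 K | ∀ w, ‖D.σ w (x : K)‖ ≤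
          b + (∑ w, ‖D.σ w ((u.1 : 𝓞 K) : K)‖) * |a|}).Finite :=
      hU.biUnion fun u _ => (D.finite_integers _).image _
    refine Set.Finite.of_finite_image (f := fun γ : D.Γ => (D.trans γ, D.mult γ))
      (hfin.subset ?_) ?_
    · rintro _ ⟨γ, ⟨_, ⟨z, hz, rfl⟩, hγz⟩, rfl⟩
      simp only [Set.mem_iUnion]
      refine ⟨γ.right, ?_, ⟨D.trans γ, ?_, rfl⟩⟩
      · intro w hw
        have h1 := (ha z hz).2 w hw
        have h2 := (hb _ hγz).2 w hw
        have hp : 0 < (D.σ w (D.mult γ : K)).re := D.σ_unit_pos hw γ.right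
        have h3 : ((γ • z).1 w).im = (D.σ w (D.mult γ : K)).re * (z.1 w).im := by
          rw [D.smul_apply]
          simp [Complex.mul_im, D.im_σ hw]
        have h4 : Real.log ((γ • z).1 w).im =
            Real.log (D.σ w (D.mult γ : K)).re + Real.log (z.1 w).im := by
          rw [h3, Real.log_mul hp.ne' (z.2 w hw).ne']
        change |Real.log (D.σ w (D.mult γ : K)).re| ≤ a + b
        have h5 : |Real.log ((γ • z).1 w).im| ≤ b := h2
        rw [h4] at h5
        rw [abs_le] at *
        constructor <;> linarith [h1.1, h1.2, h5.1, h5.2]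
      · intro w
        have h1 := (ha z hz).1 w
        have h2 : ‖(γ • z).1 w‖ ≤ b := (hb _ hγz).1 w
        have h3 : D.σ w (D.trans γ : K) = (γ • z).1 w - D.σ w (D.mult γ : K) * z.1 w := by
          rw [D.smul_apply]; ring
        have h4 : ‖D.σ w (D.mult γ : K)‖ ≤ ∑ w, ‖D.σ w (D.mult γ : K)‖ :=
          Finset.single_le_sum (f := fun w => ‖D.σ w (D.mult γ : K)‖)
            (fun i _ => norm_nonneg _) (Finset.mem_univ w)
        change ‖D.σ w (D.trans γ : K)‖ ≤ b + (∑ w, ‖D.σ w (D.mult γ : K)‖) * |a|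
        rw [h3]
        refine (norm_sub_le _ _).trans (add_le_add h2 ?_)
        rw [norm_mul]
        exact mul_le_mul h4 (h1.trans (le_abs_self a)) (norm_nonneg _)
          (Finset.sum_nonneg fun i _ => norm_nonneg _)
    · intro γ _ δ _ h
      exact D.ext_Γ (congrArg Prod.fst h) (congrArg Prod.snd h)

instance : LocallyCompactSpace (halfSpace K) :=
  (halfSpace K).isOpen.isOpenEmbedding_subtypeVal.locallyCompactSpace

/-- The OT-manifold `X(M, U)`, the quotient of `ℍˢ × ℂᵗ` by the action of `Γ = U ⋉ M`, with the
quotient topology. Its charts, with values in `ℂᵐ`, are the local inverses of the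
quotient map. -/
abbrev X : Type _ := MulAction.orbitRel.Quotient D.Γ (halfSpace K)

/-- The quotient map `ℍˢ × ℂᵗ → X(M, U)`. -/
def proj (z : halfSpace K) : D.X := Quotient.mk _ z

lemma proj_eq_iff {y z : halfSpace K} : D.proj y = D.proj z ↔ ∃ γ : D.Γ, γ • z = y :=
  Quotient.eq''

lemma isLocalHomeomorph_proj : IsLocalHomeomorph D.proj :=
  (isQuotientCoveringMap_quotientMk_of_properlyDiscontinuousSMul
    (G := D.Γ) (E := halfSpace K)).isCoveringMap.isLocalHomeomorph

/-- Every chart of `X(M, U)` is inverse to the quotient map. -/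
lemma exists_symm_eq {e : OpenPartialHomeomorph D.X (InfinitePlace K → ℂ)}
    (he : e ∈ atlas (InfinitePlace K → ℂ) D.X) {z : InfinitePlace K → ℂ} (hz : z ∈ e.target) :
    ∃ h : z ∈ halfSpace K, e.symm z = D.proj ⟨z, h⟩ := by
  obtain ⟨q, rfl⟩ := he
  set g := (Quotient.mk_surjective (s := MulAction.orbitRel D.Γ (halfSpace K))).hasRightInverse.choose q
  set c := chartAt (InfinitePlace K → ℂ) g with hc
  have hzc : z ∈ c.target := hz.1
  have hval : (c.symm z).1 = z := c.right_inv hzc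
  have hmem : z ∈ halfSpace K := hval ▸ (c.symm z).2
  refine ⟨hmem, ?_⟩
  have h1 : c.symm z = ⟨z, hmem⟩ := Subtype.ext hval
  rw [← h1]
  have h2 : (D.isLocalHomeomorph_proj.localInverseAt g).symm = D.proj :=
    D.isLocalHomeomorph_proj.localInverseAt_symm _
  exact congrFun h2 (c.symm z)

/-- `X(M, U)` is a complex manifold: the transition maps are holomorphic. -/
instance : IsManifold 𝓘(ℂ, InfinitePlace K → ℂ) ω D.X := by
  refine isManifold_of_contDiffOn _ _ _ fun e e' he he' => ?_
  simp only [modelWithCornersSelf_coe, modelWithCornersSelf_coe_symm, Function.id_comp,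
    Function.comp_id, Set.preimage_id, Set.range_id, Set.inter_univ]
  intro z hz
  refine ContDiffAt.contDiffWithinAt ?_
  have hs : IsOpen (e.symm.trans e').source := (e.symm.trans e').open_source
  have hz1 : z ∈ e.target := by simpa using hz.1
  have hz2 : e.symm z ∈ e'.source := by simpa using hz.2
  obtain ⟨hzH, hze⟩ := D.exists_symm_eq he hz1
  obtain ⟨hyH, hye⟩ := D.exists_symm_eq he' (e'.map_source hz2)
  have hyz := hye.symm.trans ((e'.left_inv hz2).trans hze)
  obtain ⟨γ, hγ⟩ := D.proj_eq_iff.1 hyz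
  let T : (InfinitePlace K → ℂ) → (InfinitePlace K → ℂ) :=
    fun x w => D.σ w (D.trans γ : K) + D.σ w (D.mult γ : K) * x w
  have hT : ContDiff ℂ ω T := by
    refine contDiff_pi.2 fun w => ?_
    exact contDiff_const.add (contDiff_const.mul (contDiff_apply ℂ ℂ w))
  have hTz : T z = e' (e.symm z) := congrArg Subtype.val hγ
  refine hT.contDiffAt.congr_of_eventuallyEq ?_
  have hev : ∀ᶠ x in 𝓝 z, T x ∈ e'.target := by
    refine hT.continuous.continuousAt.eventually_mem (e'.open_target.mem_nhds ?_)
    rw [hTz]; exact e'.map_source hz2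
  filter_upwards [hs.mem_nhds hz, hev] with x hx hTx
  have hx1 : x ∈ e.target := by simpa using hx.1
  obtain ⟨hxH, hxe⟩ := D.exists_symm_eq he hx1
  obtain ⟨hTH, hTe⟩ := D.exists_symm_eq he' hTx
  have h1 : e'.symm (T x) = e.symm x := by
    rw [hTe, hxe, D.proj_eq_iff]
    exact ⟨γ, rfl⟩
  change e' (e.symm x) = T x
  rw [← h1, e'.right_inv hTx]

/-- The space `H⁰(X, T_X)` of holomorphic vector fields on `X = X(M, U)`: the sections of the
holomorphic tangent bundle that are complex differentiable as maps `X → T_X`. -/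
def holomorphicVectorFields :
    Submodule ℂ (∀ p : D.X, TangentSpace 𝓘(ℂ, InfinitePlace K → ℂ) p) where
  carrier := {v | MDifferentiable 𝓘(ℂ, InfinitePlace K → ℂ)
    (𝓘(ℂ, InfinitePlace K → ℂ).prod 𝓘(ℂ, InfinitePlace K → ℂ))
    (fun p => (⟨p, v p⟩ : TangentBundle 𝓘(ℂ, InfinitePlace K → ℂ) D.X))}
  zero_mem' := Bundle.mdifferentiable_zeroSection ℂ _
  add_mem' hv hw := mdifferentiable_add_section hv hw
  smul_mem' _ _ hv := mdifferentiable_smul_const_section hv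

end Datum

end OT

end

/-!
A holomorphic vector field `v` on `X` pulls back to a holomorphic map `f` from `ℍˢ × ℂᵗ` to `ℂᵐ`
that is equivariant: an element of `Γ` with multiplier `a` multiplies the coordinate `f w` by
`σ w a` (`pullback_smul`, `differentiableOn_pullback`). In particular each `f w` is invariant under
the translations by `M`, hence under those by `N 𝓞 K` for some `N ≠ 0`.

The main point is that such a periodic holomorphic function is constant
(`apply_eq_apply_of_periodic`). As `N 𝓞 K` is cocompact in `ℝˢ × ℂᵗ`, the function is bounded on
each translate of `ℝˢ × ℂᵗ`, so by Liouville's theorem it does not depend on the coordinates at the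
complex places. The projection of `N 𝓞 K` to `ℝˢ` is dense (`exists_norm_sub_mul_lt`); this uses
that there is a complex place, and comes from a unit that is small at all the real places. Hence the
function is constant on each translate of `ℝˢ × ℂᵗ`, and its complex derivative vanishes on a
subspace that spans `ℂᵐ` over `ℂ`.

Now `f w` is a constant `c` with `c = σ w a * c` for all `a ∈ U`. Since there is a real place, `U`
contains some `a ≠ 1` (`exists_ne_one`), so `c = 0`.
-/

noncomputable section

namespace OT.Datum

variable {K : Type*} [Field K] [NumberField K] (D : Datum K)

/-! ### Integers in `ℝˢ × ℂᵗ` and their projection to `ℝˢ` -/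

/-- The embedding `x ↦ (σ₁(x), …, σ_m(x))` of `K` in `ℂᵐ`. -/
def emb (x : K) : InfinitePlace K → ℂ := fun w => D.σ w x

/-- The algebraic integers are relatively dense in `ℝˢ × ℂᵗ`, because they form a full lattice. -/
lemma exists_norm_sub_emb_le : ∃ R : ℝ, ∀ r : InfinitePlace K → ℂ,
    (∀ w : InfinitePlace K, w.IsReal → (r w).im = 0) →
      ∃ b : 𝓞 K, ∀ w, ‖r w - D.σ w (b : K)‖ ≤ R := by
  classical
  refine ⟨∑ i, ‖mixedEmbedding.latticeBasis K i‖, fun r hr => ?_⟩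
  -- At a complex place `σ w` may be the conjugate of `w.embedding`, which defines `mixedEmbedding`.
  let m : mixedEmbedding.mixedSpace K := (fun w => (r w.1).re,
    fun w => if D.σ w.1 = w.1.embedding then r w.1 else (starRingEnd ℂ) (r w.1))
  have hfl := (mixedEmbedding.mem_span_latticeBasis K).1
    (ZSpan.floor (mixedEmbedding.latticeBasis K) m).2
  obtain ⟨b, hb⟩ := hfl
  have hn := ZSpan.norm_fract_le (K := ℝ) (mixedEmbedding.latticeBasis K) m
  rw [ZSpan.fract_apply, ← hb] at hn
  refine ⟨b, fun w => le_trans ?_ hn⟩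
  rcases w.isReal_or_isComplex with hw | hw
  · refine le_trans (le_of_eq ?_)
      ((norm_le_pi_norm (m - mixedEmbedding K (b : K)).1 ⟨w, hw⟩).trans (norm_fst_le _))
    have h1 : r w - D.σ w (b : K) = (((r w).re - (D.σ w (b : K)).re : ℝ) : ℂ) :=
      Complex.ext (by simp) (by simp [hr w hw, D.im_σ hw])
    have h2 : InfinitePlace.embedding_of_isReal hw (b : K) = (D.σ w (b : K)).re := by
      rw [D.σ_of_isReal hw, ← InfinitePlace.embedding_of_isReal_apply hw, Complex.ofReal_re]
    rw [h1, Complex.norm_real]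
    simp [m, h2]
  · refine le_trans (le_of_eq ?_)
      ((norm_le_pi_norm (m - mixedEmbedding K (b : K)).2 ⟨w, hw⟩).trans (norm_snd_le _))
    by_cases h : D.σ w = w.embedding
    · simp [m, h]
    · have h1 : w.embedding = ComplexEmbedding.conjugate (D.σ w) := by
        have := InfinitePlace.embedding_mk_eq (D.σ w)
        rw [D.mk_σ] at this
        exact this.resolve_left fun h' => h h'.symm
      have h2 : w.embedding (b : K) = (starRingEnd ℂ) (D.σ w (b : K)) := by
        rw [h1, ComplexEmbedding.conjugate_coe_eq]
      simp only [m, if_neg h, Prod.snd_sub, Pi.sub_apply,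
        mixedEmbedding.mixedEmbedding_apply_isComplex, h2]
      rw [← map_sub, RCLike.norm_conj]

/-- Since there is a complex place, some unit is small at all the real places. -/
lemma exists_unit_norm_lt_one :
    ∃ u : (𝓞 K)ˣ, ∀ w : InfinitePlace K, w.IsReal → ‖D.σ w ((u : 𝓞 K) : K)‖ < 1 := by
  obtain ⟨w₁, hw₁⟩ := D.exists_isComplex
  obtain ⟨u, hu⟩ := Units.dirichletUnitTheorem.exists_unit K w₁
  refine ⟨u, fun w hw => ?_⟩
  have hne : w ≠ w₁ := by
    rintro rfl
    exact InfinitePlace.not_isReal_iff_isComplex.2 hw₁ hw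
  have h := hu w hne
  have h2 : w ((u : 𝓞 K) : K) = ‖D.σ w ((u : 𝓞 K) : K)‖ := by
    conv_lhs => rw [← D.mk_σ w]
    rw [InfinitePlace.apply]
  rw [← h2]
  by_contra! hc
  exact absurd h (not_lt.2 (Real.log_nonneg hc))

/-- The projection of `N 𝓞 K` to `ℝˢ` is dense: multiplication by a high power of a unit that is
small at the real places shrinks the holes of the relatively dense set of integers. -/
lemma exists_norm_sub_mul_lt {N : ℕ} (hN : N ≠ 0) (r : InfinitePlace K → ℂ)
    (hr : ∀ w : InfinitePlace K, w.IsReal → (r w).im = 0) {ε : ℝ} (hε : 0 < ε) :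
    ∃ b : 𝓞 K, ∀ w : InfinitePlace K, w.IsReal → ‖r w - D.σ w ((N * b : 𝓞 K) : K)‖ < ε := by
  classical
  obtain ⟨R, hR⟩ := D.exists_norm_sub_emb_le
  obtain ⟨u, hu⟩ := D.exists_unit_norm_lt_one
  have hk : ∀ w : InfinitePlace K, ∀ᶠ k : ℕ in Filter.atTop, w.IsReal →
      N * ‖D.σ w ((u : 𝓞 K) : K)‖ ^ k * R < ε := by
    intro w
    by_cases hw : w.IsReal
    · have h := ((tendsto_pow_atTop_nhds_zero_of_lt_one (norm_nonneg _) (hu w hw)).const_mul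
        (N : ℝ)).mul_const R
      rw [mul_zero, zero_mul] at h
      filter_upwards [h.eventually_lt_const hε] with k hk _ using hk
    · exact Filter.Eventually.of_forall fun k h => absurd h hw
  obtain ⟨k, hk⟩ := (Filter.eventually_all.2 hk).exists
  obtain ⟨b, hb⟩ := hR (fun w => if w.IsReal then
      r w / (N * D.σ w ((u : 𝓞 K) : K) ^ k) else 0) fun w hw => by
    have h1 : D.σ w ((u : 𝓞 K) : K) = ((D.σ w ((u : 𝓞 K) : K)).re : ℂ) :=
      Complex.ext (by simp) (by simpa using D.im_σ hw _)
    have h2 : r w = ((r w).re : ℂ) := Complex.ext (by simp) (by simpa using hr w hw)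
    simp only [if_pos hw]
    rw [h1, h2]
    norm_cast
  refine ⟨u ^ k * b, fun w hw => ?_⟩
  have hb := hb w
  simp only [if_pos hw] at hb
  have hne : D.σ w ((u : 𝓞 K) : K) ≠ 0 := by simp
  have hN' : (N : ℂ) ≠ 0 := by exact_mod_cast hN
  have key : r w - D.σ w ((N * (u ^ k * b) : 𝓞 K) : K) =
      (N * D.σ w ((u : 𝓞 K) : K) ^ k) *
        (r w / (N * D.σ w ((u : 𝓞 K) : K) ^ k) - D.σ w (b : K)) := by
    have : D.σ w ((N * (u ^ k * b) : 𝓞 K) : K) =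
        N * (D.σ w ((u : 𝓞 K) : K) ^ k * D.σ w (b : K)) := by simp
    rw [this]
    field_simp
  rw [key, norm_mul, norm_mul, norm_pow, Complex.norm_natCast]
  exact (mul_le_mul_of_nonneg_left hb (by positivity)).trans_lt (hk w hw)

lemma exists_natCast_mul_mem : ∃ N : ℕ, N ≠ 0 ∧ ∀ b : 𝓞 K, (N * b : 𝓞 K) ∈ D.M := by
  have h : Module.finrank ℤ (AddSubgroup.toIntSubmodule D.M) = Module.finrank ℤ (𝓞 K) :=
    D.rank_M.trans (RingOfIntegers.rank K).symm
  have hfin : Finite (𝓞 K ⧸ AddSubgroup.toIntSubmodule D.M) :=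
    Submodule.finiteQuotientOfFreeOfRankEq _ h
  have hfin' : D.M.FiniteIndex := by
    have : Finite (𝓞 K ⧸ D.M) := hfin
    exact AddSubgroup.finiteIndex_of_finite_quotient
  refine ⟨D.M.index, hfin'.index_ne_zero, fun b => ?_⟩
  rw [← nsmul_eq_mul]
  exact D.M.nsmul_index_mem b

/-! ### Periodic holomorphic functions on `ℍˢ × ℂᵗ` -/

lemma add_mem_halfSpace {z r : InfinitePlace K → ℂ} (hz : z ∈ halfSpace K)
    (hr : ∀ w : InfinitePlace K, w.IsReal → (r w).im = 0) : z + r ∈ halfSpace K := by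
  intro w hw
  have := hz w hw
  simpa [hr w hw] using this

lemma emb_im {w : InfinitePlace K} (hw : w.IsReal) (x : K) : (D.emb x w).im = 0 := D.im_σ hw x

variable {D} {f : (InfinitePlace K → ℂ) → ℂ} {N : ℕ}

/-- A continuous function on `ℍˢ × ℂᵗ` that is periodic under `N 𝓞 K` is bounded on every
translate of `ℝˢ × ℂᵗ`, because `N 𝓞 K` is cocompact there. -/
lemma exists_norm_le_of_periodic (hN : N ≠ 0) (hf : ContinuousOn f (halfSpace K))
    (hper : ∀ b : 𝓞 K, ∀ z ∈ halfSpace K, f (z + D.emb ((N * b : 𝓞 K) : K)) = f z)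
    {z : InfinitePlace K → ℂ} (hz : z ∈ halfSpace K) :
    ∃ C : ℝ, ∀ r : InfinitePlace K → ℂ,
      (∀ w : InfinitePlace K, w.IsReal → (r w).im = 0) → ‖f (z + r)‖ ≤ C := by
  obtain ⟨R, hR⟩ := D.exists_norm_sub_emb_le
  let S : Set (InfinitePlace K → ℂ) := Metric.closedBall 0 (N * R) ∩
    ⋂ w : InfinitePlace K, {r | w.IsReal → (r w).im = 0}
  have hS : IsCompact S := by
    refine (isCompact_closedBall _ _).inter_right (isClosed_iInter fun w => ?_)
    by_cases hw : w.IsReal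
    · simp only [hw, true_imp_iff]
      exact isClosed_eq (by fun_prop) continuous_const
    · simp [hw]
  obtain ⟨C, hC⟩ := hS.exists_bound_of_continuousOn (f := fun r => f (z + r))
    (hf.comp (by fun_prop) fun r hr => add_mem_halfSpace hz (by simpa using hr.2))
  refine ⟨C, fun r hr => ?_⟩
  obtain ⟨b, hb⟩ := hR (fun w => r w / N) fun w hw => by
    rw [← Complex.ofReal_natCast, Complex.div_ofReal_im, hr w hw, zero_div]
  set s := r - D.emb ((N * b : 𝓞 K) : K) with hs
  have hsE : ∀ w : InfinitePlace K, w.IsReal → (s w).im = 0 := fun w hw => by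
    simp [hs, hr w hw, D.emb_im hw, -map_mul]
  have hN' : (N : ℂ) ≠ 0 := by exact_mod_cast hN
  have hsS : s ∈ S := by
    have hR0 : 0 ≤ R := (norm_nonneg _).trans (hb D.exists_isReal.choose)
    refine ⟨?_, by simpa using hsE⟩
    rw [mem_closedBall_zero_iff, pi_norm_le_iff_of_nonneg (by positivity)]
    intro w
    have : s w = N * (r w / N - D.σ w (b : K)) := by
      simp only [hs, emb, Pi.sub_apply]
      push_cast
      rw [map_mul, map_natCast]
      field_simp
    rw [this, norm_mul, Complex.norm_natCast]
    exact mul_le_mul_of_nonneg_left (hb w) (by positivity)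
  have h1 : z + r = (z + s) + D.emb ((N * b : 𝓞 K) : K) := by rw [hs]; abel
  rw [h1, hper b _ (add_mem_halfSpace hz hsE)]
  exact hC s hsS

/-- By Liouville's theorem, a periodic holomorphic function does not depend on the coordinates
at the complex places. -/
lemma apply_add_eq_of_forall_isReal (hN : N ≠ 0) (hf : DifferentiableOn ℂ f (halfSpace K))
    (hper : ∀ b : 𝓞 K, ∀ z ∈ halfSpace K, f (z + D.emb ((N * b : 𝓞 K) : K)) = f z)
    {z d : InfinitePlace K → ℂ} (hz : z ∈ halfSpace K)
    (hd : ∀ w : InfinitePlace K, w.IsReal → d w = 0) : f (z + d) = f z := by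
  obtain ⟨C, hC⟩ := exists_norm_le_of_periodic hN hf.continuousOn hper hz
  have hE (t : ℂ) : ∀ w : InfinitePlace K, w.IsReal → ((t • d) w).im = 0 := fun w hw => by
    simp [hd w hw]
  have hdiff : Differentiable ℂ fun t : ℂ => f (z + t • d) := fun t => by
    have h1 : DifferentiableAt ℂ f (z + t • d) :=
      hf.differentiableAt ((halfSpace K).isOpen.mem_nhds (add_mem_halfSpace hz (hE t)))
    exact h1.comp t (f := fun t : ℂ => z + t • d) (by fun_prop)
  have hb : Bornology.IsBounded (Set.range fun t : ℂ => f (z + t • d)) := by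
    rw [isBounded_iff_forall_norm_le]
    exact ⟨C, by rintro _ ⟨t, rfl⟩; exact hC _ (hE t)⟩
  simpa using hdiff.apply_eq_apply_of_bounded hb 1 0

/-- A periodic holomorphic function is constant on every translate of `ℝˢ × ℂᵗ`: its periods are
dense up to the coordinates at the complex places, on which it does not depend. -/
lemma apply_add_eq_of_forall_im (hN : N ≠ 0) (hf : DifferentiableOn ℂ f (halfSpace K))
    (hper : ∀ b : 𝓞 K, ∀ z ∈ halfSpace K, f (z + D.emb ((N * b : 𝓞 K) : K)) = f z)
    {z r : InfinitePlace K → ℂ} (hz : z ∈ halfSpace K)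
    (hr : ∀ w : InfinitePlace K, w.IsReal → (r w).im = 0) : f (z + r) = f z := by
  classical
  choose b hb using fun k : ℕ =>
    D.exists_norm_sub_mul_lt hN r hr (ε := 1 / ((k : ℝ) + 1)) (by positivity)
  let e (k : ℕ) : InfinitePlace K → ℂ := D.emb ((N * b k : 𝓞 K) : K)
  -- `d k` moves the complex coordinates of the period `e k` to those of `r`.
  let d (k : ℕ) : InfinitePlace K → ℂ := fun w => if w.IsReal then 0 else r w - e k w
  have heE (k : ℕ) : ∀ w : InfinitePlace K, w.IsReal → (e k w).im = 0 := fun w hw => D.emb_im hw _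
  have hval (k : ℕ) : f (z + (e k + d k)) = f z := by
    rw [← add_assoc, apply_add_eq_of_forall_isReal hN hf hper (add_mem_halfSpace hz (heE k))
      (fun w hw => by simp [d, hw])]
    exact hper (b k) z hz
  have hlim : Filter.Tendsto (fun k => z + (e k + d k)) Filter.atTop (𝓝 (z + r)) := by
    refine tendsto_const_nhds.add (tendsto_pi_nhds.2 fun w => ?_)
    by_cases hw : w.IsReal
    · rw [tendsto_iff_norm_sub_tendsto_zero]
      refine squeeze_zero (fun _ => norm_nonneg _) (fun k => ?_)
        tendsto_one_div_add_atTop_nhds_zero_nat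
      rw [norm_sub_rev]
      simpa [d, hw, e, emb] using (hb k w hw).le
    · simp [d, hw]
  have hc : ContinuousAt f (z + r) :=
    hf.continuousOn.continuousAt ((halfSpace K).isOpen.mem_nhds (add_mem_halfSpace hz hr))
  have h := hc.tendsto.comp hlim
  have h2 : f ∘ (fun k => z + (e k + d k)) = fun _ => f z := funext hval
  rw [h2] at h
  exact tendsto_nhds_unique h tendsto_const_nhds

lemma convex_halfSpace : Convex ℝ (halfSpace K : Set (InfinitePlace K → ℂ)) := by
  intro x hx y hy a b ha hb hab w hw
  have h1 := hx w hw
  have h2 := hy w hw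
  have h3 : (((a • x + b • y) : InfinitePlace K → ℂ) w).im = a * (x w).im + b * (y w).im := by
    simp
  rw [h3]
  rcases ha.eq_or_lt with rfl | ha
  · have : b = 1 := by linarith
    simpa [this] using h2
  · have := mul_pos ha h1
    have := mul_nonneg hb h2.le
    linarith

/-- A periodic holomorphic function is constant: its derivative vanishes on `ℝˢ × ℂᵗ`, which spans
`ℂᵐ` over `ℂ`. -/
lemma apply_eq_apply_of_periodic (hN : N ≠ 0) (hf : DifferentiableOn ℂ f (halfSpace K))
    (hper : ∀ b : 𝓞 K, ∀ z ∈ halfSpace K, f (z + D.emb ((N * b : 𝓞 K) : K)) = f z)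
    {y z : InfinitePlace K → ℂ} (hy : y ∈ halfSpace K) (hz : z ∈ halfSpace K) : f y = f z := by
  refine convex_halfSpace.is_const_of_fderivWithin_eq_zero hf (fun x hx => ?_) hy hz
  have hx' := (halfSpace K).isOpen.mem_nhds hx
  have hfx : HasFDerivAt f (fderiv ℂ f x) x := (hf.differentiableAt hx').hasFDerivAt
  rw [fderivWithin_of_mem_nhds hx']
  have hzero : ∀ r : InfinitePlace K → ℂ,
      (∀ w : InfinitePlace K, w.IsReal → (r w).im = 0) → fderiv ℂ f x r = 0 := by
    intro r hr
    have h1 : HasDerivAt (fun t : ℝ => x + t • r) r 0 := by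
      simpa using ((hasDerivAt_id (0 : ℝ)).smul_const r).const_add x
    have h2 : HasFDerivAt f ((fderiv ℂ f x).restrictScalars ℝ) (x + (0 : ℝ) • r) := by
      simpa using hfx.restrictScalars ℝ
    have h3 := h2.comp_hasDerivAt (0 : ℝ) h1
    have h4 : f ∘ (fun t : ℝ => x + t • r) = fun _ => f x := funext fun t =>
      apply_add_eq_of_forall_im hN hf hper hx fun w hw => by simp [hr w hw]
    rw [h4] at h3
    simpa using h3.unique (hasDerivAt_const (0 : ℝ) (f x))
  ext r
  have hdec : r = (fun w => ((r w).re : ℂ)) + Complex.I • fun w => ((r w).im : ℂ) := by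
    funext w
    simp [mul_comm Complex.I, Complex.re_add_im]
  rw [hdec, map_add, map_smul, hzero _ (by simp), hzero _ (by simp)]
  simp

variable (D)

/-! ### The lift of a vector field to `ℍˢ × ℂᵗ` -/

/-- The linear part of the action of `γ ∈ Γ`, which multiplies the coordinates by the `σ w (a)`. -/
def linearPart (γ : D.Γ) : (InfinitePlace K → ℂ) →L[ℂ] (InfinitePlace K → ℂ) :=
  ContinuousLinearMap.pi fun w => D.σ w (D.mult γ : K) • ContinuousLinearMap.proj w

lemma linearPart_apply (γ : D.Γ) (x : InfinitePlace K → ℂ) (w : InfinitePlace K) :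
    D.linearPart γ x w = D.σ w (D.mult γ : K) * x w := rfl

lemma linearPart_mul (γ δ : D.Γ) (x : InfinitePlace K → ℂ) :
    D.linearPart (γ * δ) x = D.linearPart γ (D.linearPart δ x) := by
  funext w
  simp only [linearPart_apply, mult_mul, map_mul]
  ring

/-- The affine map by which `γ ∈ Γ` acts, on all of `ℂᵐ`. -/
def affineMap (γ : D.Γ) (x : InfinitePlace K → ℂ) : InfinitePlace K → ℂ :=
  D.emb (D.trans γ : K) + D.linearPart γ x

lemma hasFDerivAt_affineMap (γ : D.Γ) (x : InfinitePlace K → ℂ) :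
    HasFDerivAt (D.affineMap γ) (D.linearPart γ) x :=
  (D.linearPart γ).hasFDerivAt.const_add _

/-- The preferred lift of a point of `X` to `ℍˢ × ℂᵗ`: its coordinate in the preferred chart. -/
def lift (p : D.X) : halfSpace K :=
  ⟨chartAt (InfinitePlace K → ℂ) p p, (D.exists_symm_eq (chart_mem_atlas _ p)
    (mem_chart_target _ p)).choose⟩

lemma proj_lift (p : D.X) : D.proj (D.lift p) = p := by
  obtain ⟨h, h'⟩ := D.exists_symm_eq (chart_mem_atlas _ p) (mem_chart_target _ p)
  refine Eq.trans h'.symm ?_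
  exact (chartAt (InfinitePlace K → ℂ) p).left_inv (mem_chart_source _ p)

/-- The deck transformation that moves the preferred lift of `D.proj z` to `z`. -/
def deck (z : halfSpace K) : D.Γ :=
  (D.proj_eq_iff.1 (D.proj_lift (D.proj z)).symm).choose

lemma deck_smul_lift (z : halfSpace K) : D.deck z • D.lift (D.proj z) = z :=
  (D.proj_eq_iff.1 (D.proj_lift (D.proj z)).symm).choose_spec

lemma proj_smul (γ : D.Γ) (z : halfSpace K) : D.proj (γ • z) = D.proj z :=
  D.proj_eq_iff.2 ⟨γ, rfl⟩

lemma eq_of_smul_eq {γ δ : D.Γ} {z : halfSpace K} (h : γ • z = δ • z) : γ = δ :=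
  IsCancelSMul.right_cancel _ _ _ h

lemma deck_smul (γ : D.Γ) (z : halfSpace K) : D.deck (γ • z) = γ * D.deck z := by
  refine D.eq_of_smul_eq (z := D.lift (D.proj z)) ?_
  have h := D.deck_smul_lift (γ • z)
  rw [D.proj_smul] at h
  rw [h, mul_smul, D.deck_smul_lift]

/-- If `γ ∈ Γ` moves a point of the target of one chart of `X` into the target of another, then near
this point the transition map is the deck transformation `γ`. -/
lemma transition_eventuallyEq {e e' : OpenPartialHomeomorph D.X (InfinitePlace K → ℂ)}
    (he : e ∈ atlas (InfinitePlace K → ℂ) D.X) (he' : e' ∈ atlas (InfinitePlace K → ℂ) D.X)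
    {x : InfinitePlace K → ℂ} (hx : x ∈ e.target) {γ : D.Γ} (hγ : D.affineMap γ x ∈ e'.target) :
    e' ∘ e.symm =ᶠ[𝓝 x] D.affineMap γ := by
  have hev : ∀ᶠ y in 𝓝 x, D.affineMap γ y ∈ e'.target :=
    (D.hasFDerivAt_affineMap γ x).continuousAt.eventually_mem (e'.open_target.mem_nhds hγ)
  filter_upwards [e.open_target.mem_nhds hx, hev] with y hy hTy
  obtain ⟨hyH, hye⟩ := D.exists_symm_eq he hy
  obtain ⟨hTH, hTe⟩ := D.exists_symm_eq he' hTy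
  have h1 : e'.symm (D.affineMap γ y) = e.symm y := by
    rw [hTe, hye, D.proj_eq_iff]
    exact ⟨γ, rfl⟩
  rw [Function.comp_apply, ← h1, e'.right_inv hTy]

/-- The coordinate changes of the tangent bundle of `X` are the linear parts of deck
transformations. -/
lemma trivializationAt_snd {p q : D.X} {γ : D.Γ}
    (hp : p ∈ (chartAt (InfinitePlace K → ℂ) q).source)
    (hγ : (γ • D.lift p).1 = chartAt (InfinitePlace K → ℂ) q p)
    (u : TangentSpace 𝓘(ℂ, InfinitePlace K → ℂ) p) :
    (trivializationAt (InfinitePlace K → ℂ) (TangentSpace 𝓘(ℂ, InfinitePlace K → ℂ)) q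
      ⟨p, u⟩).2 = D.linearPart γ u := by
  rw [TangentBundle.trivializationAt_apply]
  simp only [OpenPartialHomeomorph.extend, modelWithCornersSelf_partialEquiv,
    PartialEquiv.trans_refl, modelWithCornersSelf_coe, Set.range_id, fderivWithin_univ,
    OpenPartialHomeomorph.toFun_eq_coe, OpenPartialHomeomorph.coe_toPartialEquiv_symm]
  have h := D.transition_eventuallyEq (chart_mem_atlas (InfinitePlace K → ℂ) p)
    (chart_mem_atlas _ q) (mem_chart_target _ p) (γ := γ) (by
      have := (chartAt (InfinitePlace K → ℂ) q).map_source hp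
      rw [← hγ] at this
      exact this)
  erw [((D.hasFDerivAt_affineMap γ _).congr_of_eventuallyEq h).fderiv]

variable (v : ∀ p : D.X, TangentSpace 𝓘(ℂ, InfinitePlace K → ℂ) p)

/-- The coordinate vector of `v p` in the preferred chart at `p`. -/
def coordVector (p : D.X) : InfinitePlace K → ℂ := v p

open Classical in
/-- The pullback of the vector field `v` to `ℍˢ × ℂᵗ`, in the coordinates of `ℂᵐ`; it is extended
by zero outside of `ℍˢ × ℂᵗ`. -/
def pullback (z : InfinitePlace K → ℂ) : InfinitePlace K → ℂ :=
  if h : z ∈ halfSpace K then D.linearPart (D.deck ⟨z, h⟩) (D.coordVector v (D.proj ⟨z, h⟩)) else 0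

lemma pullback_coe (z : halfSpace K) :
    D.pullback v z.1 = D.linearPart (D.deck z) (D.coordVector v (D.proj z)) := dif_pos z.2

/-- The pullback is `Γ`-equivariant. -/
lemma pullback_smul (γ : D.Γ) (z : halfSpace K) :
    D.pullback v (γ • z).1 = D.linearPart γ (D.pullback v z.1) := by
  rw [pullback_coe, pullback_coe, deck_smul, linearPart_mul, D.proj_smul]

variable {v}

lemma differentiableOn_pullback (hv : v ∈ D.holomorphicVectorFields) :
    DifferentiableOn ℂ (D.pullback v) (halfSpace K) := by
  intro z hz
  refine DifferentiableAt.differentiableWithinAt ?_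
  set q := D.proj ⟨z, hz⟩
  set e := chartAt (InfinitePlace K → ℂ) q
  set γ := D.deck ⟨z, hz⟩
  have hγz : γ • D.lift q = ⟨z, hz⟩ := D.deck_smul_lift _
  -- The local coordinate expression of `v` in the chart `e`.
  let g : D.X → (InfinitePlace K → ℂ) := fun p =>
    (trivializationAt (InfinitePlace K → ℂ) (TangentSpace 𝓘(ℂ, InfinitePlace K → ℂ)) q
      ⟨p, v p⟩).2
  have hg : DifferentiableAt ℂ (g ∘ e.symm) (e q) := by
    have h1 := ((mdifferentiableAt_section _ v).1 (hv q)).differentiableWithinAt_writtenInExtChartAt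
    simpa [writtenInExtChartAt, extChartAt, OpenPartialHomeomorph.extend,
      differentiableWithinAt_univ] using! h1
  have hinv : D.affineMap γ⁻¹ z = e q := by
    have : γ⁻¹ • (⟨z, hz⟩ : halfSpace K) = D.lift q := by rw [← hγz, inv_smul_smul]
    exact congrArg Subtype.val this
  have hdiff : DifferentiableAt ℂ
      (fun x => D.linearPart γ ((g ∘ e.symm) (D.affineMap γ⁻¹ x))) z := by
    rw [← hinv] at hg
    exact (D.linearPart γ).differentiableAt.comp z
      (hg.comp z (D.hasFDerivAt_affineMap γ⁻¹ z).differentiableAt)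
  refine hdiff.congr_of_eventuallyEq ?_
  have hev : ∀ᶠ x in 𝓝 z, D.affineMap γ⁻¹ x ∈ e.target := by
    refine (D.hasFDerivAt_affineMap γ⁻¹ z).continuousAt.eventually_mem (e.open_target.mem_nhds ?_)
    rw [hinv]
    exact mem_chart_target _ q
  filter_upwards [(halfSpace K).isOpen.mem_nhds hz, hev] with x hx hxe
  obtain ⟨hxH, hxp⟩ := D.exists_symm_eq (chart_mem_atlas _ q) hxe
  have hxp' : e.symm (D.affineMap γ⁻¹ x) = D.proj ⟨x, hx⟩ := by
    refine hxp.trans ?_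
    exact D.proj_smul γ⁻¹ ⟨x, hx⟩
  set p := D.proj ⟨x, hx⟩
  have hps : p ∈ e.source := by
    rw [← hxp']
    exact e.map_target hxe
  have hep : e p = D.affineMap γ⁻¹ x := by rw [← hxp', e.right_inv hxe]
  have h1 : ((γ⁻¹ * D.deck ⟨x, hx⟩) • D.lift p).1 = e p := by
    rw [mul_smul, D.deck_smul_lift, hep]
    rfl
  have h2 := D.trivializationAt_snd hps h1 (v p)
  have h3 : (g ∘ e.symm) (D.affineMap γ⁻¹ x) =
      D.linearPart (γ⁻¹ * D.deck ⟨x, hx⟩) (D.coordVector v p) := by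
    rw [Function.comp_apply, hxp']
    exact h2
  rw [h3, ← linearPart_mul, mul_inv_cancel_left]
  exact D.pullback_coe v ⟨x, hx⟩

/-! ### Vanishing -/

/-- The lattice of logarithms of `U` spans `ℝˢ` with `s > 0`, so `U` is nontrivial. -/
lemma exists_ne_one : ∃ u : D.U, u ≠ 1 := by
  by_contra! h
  obtain ⟨w, hw⟩ := D.exists_isReal
  have hU : D.U = ⊥ := (Subgroup.eq_bot_iff_forall _).2 fun u hu =>
    congrArg Subtype.val (h ⟨u, hu⟩)
  have hs := D.admissible.span_eq_top
  have h0 : ((D.U.toAddSubgroup.map (realLog K) : AddSubgroup _) :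
      Set ({w : InfinitePlace K // w.IsReal} → ℝ)) ⊆ {0} := by
    rintro _ ⟨u, hu, rfl⟩
    have : u.toMul = 1 := by
      have hu' : u.toMul ∈ D.U := hu
      rwa [hU, Subgroup.mem_bot] at hu'
    have : u = 0 := this
    simp [this]
  have h1 : (⊤ : Submodule ℝ ({w : InfinitePlace K // w.IsReal} → ℝ)) ≤ ⊥ := by
    rw [← hs, Submodule.span_le]
    exact h0
  have h2 := h1 (Submodule.mem_top (x := fun _ => (1 : ℝ)))
  exact one_ne_zero (congrFun ((Submodule.mem_bot ℝ).1 h2) ⟨w, hw⟩)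

/-- The pullback is invariant under `M`, hence constant; equivariance under a nontrivial unit
then makes it zero. -/
lemma pullback_eq_zero (hv : v ∈ D.holomorphicVectorFields) (z : halfSpace K) :
    D.pullback v z.1 = 0 := by
  funext w
  obtain ⟨N, hN, hNM⟩ := D.exists_natCast_mul_mem
  have hf : DifferentiableOn ℂ (fun x => D.pullback v x w) (halfSpace K) :=
    differentiableOn_pi.1 (D.differentiableOn_pullback hv) w
  have hper : ∀ b : 𝓞 K, ∀ x ∈ halfSpace K,
      D.pullback v (x + D.emb ((N * b : 𝓞 K) : K)) w = D.pullback v x w := by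
    intro b x hx
    let γ : D.Γ := ⟨Multiplicative.ofAdd ⟨N * b, hNM b⟩, 1⟩
    have hm : D.mult γ = 1 := rfl
    have ht : D.trans γ = N * b := rfl
    have h1 : (γ • (⟨x, hx⟩ : halfSpace K)).1 = x + D.emb ((N * b : 𝓞 K) : K) := by
      funext i
      rw [D.smul_apply, hm, ht]
      simp [emb, add_comm]
    rw [← h1, D.pullback_smul, D.linearPart_apply, hm]
    simp
  obtain ⟨u, hu⟩ := D.exists_ne_one
  let γ : D.Γ := ⟨1, u⟩
  have h1 : D.pullback v (γ • z).1 w = D.pullback v z.1 w :=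
    apply_eq_apply_of_periodic hN hf hper (γ • z).2 z.2
  rw [D.pullback_smul, D.linearPart_apply] at h1
  have h2 : D.σ w (D.mult γ : K) ≠ 1 := by
    intro h
    have h3 : ((u.1 : 𝓞 K) : K) = 1 := (D.σ w).injective (h.trans (map_one _).symm)
    exact hu (Subtype.ext (Units.ext (RingOfIntegers.coe_injective (h3.trans (map_one _).symm))))
  exact (mul_left_eq_self₀.1 h1).resolve_left h2

end OT.Datum

end

/-- An OT-manifold `X = X(M, U)` has no nonzero holomorphic vector fields: `H⁰(X, T_X) = 0`. -/
theorem lemma2p2 {K : Type*} [Field K] [NumberField K] (D : OT.Datum K) :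
    D.holomorphicVectorFields = ⊥ := by
  refine (Submodule.eq_bot_iff _).2 fun v hv => funext fun p => ?_
  have h := D.pullback_eq_zero hv (D.lift p)
  rw [D.pullback_coe, D.proj_lift] at h
  funext w
  have hw : D.σ w (D.mult (D.deck (D.lift p)) : K) * v p w = 0 := congrFun h w
  refine (mul_eq_zero.1 hw).resolve_left ?_
  refine (map_ne_zero (D.σ w)).2 ?_
  exact RingOfIntegers.coe_ne_zero_iff.2 (D.deck (D.lift p)).right.1.ne_zero
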